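/- Let $\mu$ be a $\sigma$-finite Borel measure on $\mathbb{R}$ that is $1$-periodic, i.e. $\mu(B+1)=\mu(B)$ for every Borel set $B\subseteq\mathbb{R}$. Let $n\in\mathbb{N}$, $\varphi\in[0,1)$, $a=(a_1,\dots,a_n)\in\mathbb{C}^n$, and consider the $1$-periodic trigonometric polynomial $$\psi(s)=e^{2\pi i\varphi}\sum_{k=1}^{n}a_k e^{-2\pi i ks},\qquad s\in\mathbb{R}.$$ Then, for all $\delta\in(0,1]$, $$\int_{[0,1)}|\psi(s)|^2\,\mathrm{d}\mu(s)\le\Bigl(n-1+\frac1\delta\Bigr)\,\sup_{r\in[0,1)}\mu\bigl((r,r+\delta)\bigr)\,\|a\|_2^2,$$ where $\|a\|_2^2=\sum_{k=1}^n|a_k|^2$. Both sides are elements of $[0,\infty]$, with the convention $0\cdot\infty=0$. -/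

import Mathlib

open MeasureTheory
open scoped ENNReal

/-- The trigonometric polynomial `ψ(s) = e^{2πiφ} ∑_{k=1}^n a_k e^{-2πiks}`. The coordinates of `a`
are indexed by `0, …, n-1`, so the coordinate `a k` carries the frequency `k + 1`. -/
noncomputable def trigPoly {n : ℕ} (φ : ℝ) (a : EuclideanSpace ℂ (Fin n)) (s : ℝ) : ℂ :=
  Complex.exp (2 * Real.pi * Complex.I * φ) *
    ∑ k : Fin n, a k * Complex.exp (-(2 * Real.pi * Complex.I * ((k : ℕ) + 1 : ℂ) * s))

/-- A Borel measure on `ℝ` is 1-periodic if it is invariant under translation by 1. -/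
def IsOnePeriodicMeasure (μ : Measure ℝ) : Prop :=
  ∀ B : Set ℝ, MeasurableSet B → μ ((fun x : ℝ => x + 1) '' B) = μ B

/-! This is a large sieve inequality, obtained by duality from a Selberg majorant. Put `η = δ/N`
with `N` large. The points `kη`, `0 ≤ k ≤ n-1`, lie in the arc `[0, (n-1)η]`, which has a
trigonometric majorant of degree `N-1`, of mean `(n-1)η + 1/N`, that is a finite sum of squares `∑ᵢ
|Qᵢ|²` (`exists_arc_majorant`). With `cᵢ(k) = conj Qᵢ(kη) · a_k / ∑ᵢ |Qᵢ(kη)|²`, the exponential sum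
of `a` is a combination of the translates by `jη`, `j < N`, of the exponential sums of the `cᵢ`,
whose total mass is at most that of `a`. Cauchy–Schwarz costs only the mean of the majorant
(`exists_norm_expSum_sq_le_sum_translates`).

Averaging over a further shift in `(0, η)` fits the `N` translates into one integral over `(0, δ)`.
Tonelli and the periodicity of `μ` then produce the supremum
(`IsOnePeriodicMeasure.lintegral_lintegral_sub_le`), and Parseval the norms. The constant
`(N/δ)((n-1)δ/N + 1/N) = n-1+1/δ` does not depend on `N`, so Fatou's lemma removes the averaging as
`N → ∞`.

The excess `1/N` in the mean comes from a sawtooth majorant of mean `1/(2N)`, used once at each end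
of the arc. That it is a majorant reduces to the convexity of `-t cot t` (`tangent_le_mul_cot`). -/

/-! ### Nonnegative trigonometric polynomials as sums of squares -/

open Polynomial ComplexConjugate ComplexOrder in
/-- If `p(z) z⁻ᵈ` is nonnegative on the unit circle and vanishes at `w`, then `w` is a double root. -/
theorem sq_dvd_of_nonneg_of_isRoot {d : ℕ} {p : ℂ[X]}
    (hp : ∀ z : ℂ, ‖z‖ = 1 → 0 ≤ p.eval z * conj z ^ d) {w : ℂ} (hw : ‖w‖ = 1)
    (h0 : p.eval w = 0) : (X - C w) ^ 2 ∣ p := by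
  have hw0 : w ≠ 0 := by rintro rfl; simp at hw
  by_cases hpz : p = 0
  · simp [hpz]
  suffices hd : p.derivative.eval w = 0 by
    have := (one_lt_rootMultiplicity_iff_isRoot hpz (t := w)).2 ⟨h0, hd⟩
    exact (pow_dvd_pow _ this).trans (pow_rootMultiplicity_dvd p w)
  let γ : ℝ → ℂ := fun t => w * Complex.exp (t * Complex.I)
  have hγn (t : ℝ) : ‖γ t‖ = 1 := by simp [γ, hw, Complex.norm_exp_ofReal_mul_I]
  have hγ : HasDerivAt γ (w * Complex.I) 0 := by
    have h1 : HasDerivAt (fun t : ℝ => (t : ℂ) * Complex.I) (1 * Complex.I) 0 :=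
      (Complex.ofRealCLM.hasDerivAt (x := (0 : ℝ))).mul_const _
    have := h1.cexp.const_mul w
    simpa [γ] using this
  have hγc : HasDerivAt (fun t => conj (γ t) ^ d) (_) 0 :=
    ((Complex.conjCLE.toContinuousLinearMap.hasFDerivAt.comp_hasDerivAt (0 : ℝ) hγ)).pow d
  have hγ0 : γ 0 = w := by simp [γ]
  have hpd : HasDerivAt (fun t => p.eval (γ t)) (p.derivative.eval w * (w * Complex.I)) 0 := by
    have := (p.hasDerivAt (γ 0))
    rw [hγ0] at this
    exact HasDerivAt.comp (0 : ℝ) (by rw [hγ0]; exact this) hγ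
  have hG := hpd.mul hγc
  rw [hγ0, h0, zero_mul, add_zero] at hG
  set D := p.derivative.eval w * (w * Complex.I) * conj w ^ d with hD
  -- Along the circle the real part is nonnegative and vanishes at `w`, so it has a minimum there;
  -- the imaginary part is identically zero.
  have hre : D.re = 0 := by
    have h1 : HasDerivAt (fun t => (p.eval (γ t) * conj (γ t) ^ d).re) D.re 0 :=
      Complex.reCLM.hasFDerivAt.comp_hasDerivAt (0 : ℝ) hG
    refine IsLocalMin.hasDerivAt_eq_zero (Filter.Eventually.of_forall fun t => ?_) h1
    have := (Complex.nonneg_iff.1 (hp _ (hγn t))).1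
    simpa [hγ0, h0] using this
  have him : D.im = 0 := by
    have h1 : HasDerivAt (fun t => (p.eval (γ t) * conj (γ t) ^ d).im) D.im 0 :=
      Complex.imCLM.hasFDerivAt.comp_hasDerivAt (0 : ℝ) hG
    refine IsLocalMin.hasDerivAt_eq_zero (Filter.Eventually.of_forall fun t => ?_) h1
    have h2 := (Complex.nonneg_iff.1 (hp _ (hγn t))).2
    have h3 := (Complex.nonneg_iff.1 (hp _ (hγn 0))).2
    simp only [← h2, ← h3, le_refl]
  have : D = 0 := Complex.ext hre him
  simpa [hD, hw0, Complex.I_ne_zero] using this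

open Polynomial ComplexConjugate ComplexOrder in
/-- A nonnegative trigonometric polynomial of degree `d`, written as `p(z) z⁻ᵈ` on the unit circle,
is a sum of squares of absolute values of polynomials of degree at most `d`. -/
theorem exists_eval_eq_sum_sq_of_nonneg (d : ℕ) : ∀ p : ℂ[X], p.natDegree ≤ 2 * d →
    (∀ z : ℂ, ‖z‖ = 1 → 0 ≤ p.eval z * conj z ^ d) →
    ∃ (ι : Type) (_ : Fintype ι) (Q : ι → ℂ[X]), (∀ i, (Q i).natDegree ≤ d) ∧
      ∀ z : ℂ, ‖z‖ = 1 → p.eval z * conj z ^ d = ((∑ i, ‖(Q i).eval z‖ ^ 2 : ℝ) : ℂ) := by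
  induction d with
  | zero =>
    intro p hdeg hp
    obtain ⟨c, rfl⟩ : ∃ c, p = C c := ⟨_, eq_C_of_natDegree_le_zero (by simpa using hdeg)⟩
    have hc := hp 1 (by simp)
    simp only [eval_C, pow_zero, mul_one] at hc
    obtain ⟨r, hr, rfl⟩ : ∃ r : ℝ, 0 ≤ r ∧ (r : ℂ) = c :=
      ⟨c.re, (Complex.nonneg_iff.1 hc).1, Complex.ext rfl (by simpa using (Complex.nonneg_iff.1 hc).2)⟩
    refine ⟨Unit, inferInstance, fun _ => C ((√r : ℝ) : ℂ), by simp, fun z _ => ?_⟩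
    simp [Real.sq_sqrt hr]
  | succ d ih =>
    intro p hdeg hp
    have hzz (z : ℂ) (hz : ‖z‖ = 1) : z * conj z = 1 := by
      rw [Complex.mul_conj, Complex.normSq_eq_norm_sq, hz]; simp
    -- Subtracting the minimum value `c` creates a double root on the circle while keeping
    -- nonnegativity; `c` itself is one of the squares.
    obtain ⟨w, hw, hmin⟩ := (isCompact_sphere (0 : ℂ) 1).exists_isMinOn ⟨1, by simp⟩
      (f := fun z => (p.eval z * conj z ^ (d + 1)).re) (by fun_prop)
    replace hw : ‖w‖ = 1 := by simpa using hw
    set c : ℝ := (p.eval w * conj w ^ (d + 1)).re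
    have hc0 : 0 ≤ c := (Complex.nonneg_iff.1 (hp w hw)).1
    have hcw : p.eval w * conj w ^ (d + 1) = c :=
      Complex.ext rfl (by simpa using (Complex.nonneg_iff.1 (hp w hw)).2.symm)
    let p₁ : ℂ[X] := p - C (c : ℂ) * X ^ (d + 1)
    have hp₁e (z : ℂ) (hz : ‖z‖ = 1) :
        p₁.eval z * conj z ^ (d + 1) = p.eval z * conj z ^ (d + 1) - c := by
      have : z ^ (d + 1) * conj z ^ (d + 1) = 1 := by rw [← mul_pow, hzz z hz, one_pow]
      simp only [p₁, eval_sub, eval_mul, eval_C, eval_pow, eval_X]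
      linear_combination (-(c : ℂ)) * this
    have hp₁ (z : ℂ) (hz : ‖z‖ = 1) : 0 ≤ p₁.eval z * conj z ^ (d + 1) := by
      rw [hp₁e z hz, Complex.nonneg_iff]
      have h1 : c ≤ (p.eval z * conj z ^ (d + 1)).re := hmin (by simpa using hz)
      have h2 := (Complex.nonneg_iff.1 (hp z hz)).2
      refine ⟨?_, ?_⟩
      · rw [Complex.sub_re, Complex.ofReal_re]; linarith
      · rw [Complex.sub_im, Complex.ofReal_im, ← h2]; simp
    have hw0 : w ≠ 0 := by rintro rfl; simp at hw
    have hroot : p₁.eval w = 0 := by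
      have h := hp₁e w hw
      rw [hcw, sub_self] at h
      simpa [hw0] using h
    obtain ⟨p₂, hp₂⟩ := sq_dvd_of_nonneg_of_isRoot hp₁ hw hroot
    have hdeg₁ : p₁.natDegree ≤ 2 * (d + 1) := by
      refine (natDegree_sub_le _ _).trans (max_le hdeg ?_)
      exact (natDegree_C_mul_X_pow_le _ _).trans (by omega)
    have hdeg₂ : p₂.natDegree ≤ 2 * d := by
      by_cases h0 : p₂ = 0
      · simp [h0]
      · have hm : ((X - C w) ^ 2).Monic := (monic_X_sub_C w).pow 2
        rw [hp₂, hm.natDegree_mul' h0, natDegree_pow, natDegree_X_sub_C] at hdeg₁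
        omega
    -- On the circle `(z - w)² conj z = -w |z - w|²`, so removing the double root lowers the degree
    -- `d + 1` by one at the price of the factor `-w`.
    let p₃ : ℂ[X] := C (-w) * p₂
    have hrel (z : ℂ) (hz : ‖z‖ = 1) : p₁.eval z * conj z ^ (d + 1) =
        ((‖z - w‖ ^ 2 : ℝ) : ℂ) * (p₃.eval z * conj z ^ d) := by
      have h1 : ((‖z - w‖ ^ 2 : ℝ) : ℂ) = (z - w) * (conj z - conj w) := by
        rw [← map_sub, Complex.mul_conj, Complex.normSq_eq_norm_sq]
      rw [h1, hp₂]
      simp only [p₃, eval_mul, eval_pow, eval_sub, eval_X, eval_C, pow_succ]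
      linear_combination ((z - w) * p₂.eval z * conj z ^ d) * (hzz z hz - hzz w hw)
    have hp₃ne (z : ℂ) (hz : ‖z‖ = 1) (hne : z ≠ w) : 0 ≤ p₃.eval z * conj z ^ d := by
      have h1 := hp₁ z hz
      have h2 : 0 < ‖z - w‖ ^ 2 := by have := norm_pos_iff.2 (sub_ne_zero.2 hne); positivity
      rw [hrel z hz, Complex.nonneg_iff, Complex.re_ofReal_mul, Complex.im_ofReal_mul] at h1
      refine Complex.nonneg_iff.2 ⟨(mul_nonneg_iff_of_pos_left h2).1 h1.1, ?_⟩
      exact ((mul_eq_zero.1 h1.2.symm).resolve_left h2.ne').symm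
    -- At `z = w` one cannot divide by `|z - w|²`; the sign there follows by continuity along the
    -- circle.
    have hp₃ (z : ℂ) (hz : ‖z‖ = 1) : 0 ≤ p₃.eval z * conj z ^ d := by
      rcases ne_or_eq z w with hne | rfl
      · exact hp₃ne z hz hne
      let γ : ℝ → ℂ := fun t => z * Complex.exp (t * Complex.I)
      have hcont : Continuous fun t => p₃.eval (γ t) * conj (γ t) ^ d := by
        have : Continuous γ := by fun_prop
        fun_prop
      have hlim := (hcont.tendsto 0).mono_left (nhdsWithin_le_nhds (s := Set.Ioi 0))
      have hγ0 : γ 0 = z := by simp [γ]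
      rw [hγ0] at hlim
      refine ge_of_tendsto hlim ?_
      filter_upwards [Ioo_mem_nhdsGT Real.pi_pos] with t ht
      refine hp₃ne _ (by simp [γ, hw, Complex.norm_exp_ofReal_mul_I]) fun h => ?_
      have h1 : Complex.exp (t * Complex.I) = 1 := by
        simpa [γ, hw0] using h
      have h2 := congrArg Complex.im h1
      rw [Complex.exp_ofReal_mul_I_im, Complex.one_im] at h2
      exact (Real.sin_pos_of_mem_Ioo ht).ne' h2
    obtain ⟨ι, _, Q, hQd, hQ⟩ := ih p₃ ((natDegree_C_mul_le _ _).trans hdeg₂) hp₃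
    refine ⟨Option ι, inferInstance,
      fun i => i.elim (C ((√c : ℝ) : ℂ)) fun i => (X - C w) * Q i, ?_, fun z hz => ?_⟩
    · rintro (_ | i)
      · simp
      · refine natDegree_mul_le.trans ?_
        have := hQd i
        simp only [natDegree_X_sub_C]
        omega
    · have h1 := hp₁e z hz
      rw [hrel z hz, hQ z hz] at h1
      rw [← sub_add_cancel (p.eval z * conj z ^ (d + 1)) (c : ℂ), ← h1]
      simp [Fintype.sum_option, mul_pow, Finset.mul_sum, Real.sq_sqrt hc0, add_comm]

/-! ### Characters of the circle and their orthogonality -/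

/-- The character `x ↦ e^{2πix}`. -/
noncomputable def unitExp (x : ℝ) : ℂ := Complex.exp (2 * Real.pi * x * Complex.I)

theorem unitExp_eq (x : ℝ) : unitExp x = Complex.exp (Complex.I * (2 * Real.pi * x : ℝ)) := by
  rw [unitExp]; congr 1; push_cast; ring

theorem unitExp_add (x y : ℝ) : unitExp (x + y) = unitExp x * unitExp y := by
  rw [unitExp, unitExp, unitExp, ← Complex.exp_add]; congr 1; push_cast; ring

@[simp] theorem unitExp_zero : unitExp 0 = 1 := by simp [unitExp]

@[simp] theorem norm_unitExp (x : ℝ) : ‖unitExp x‖ = 1 := by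
  rw [unitExp_eq, Complex.norm_exp_I_mul_ofReal]

open ComplexConjugate in
theorem conj_unitExp (x : ℝ) : conj (unitExp x) = unitExp (-x) := by
  rw [unitExp_eq, unitExp_eq, ← Complex.exp_conj, map_mul, Complex.conj_I, Complex.conj_ofReal]
  congr 1; push_cast; ring

theorem unitExp_nat_mul (k : ℕ) (x : ℝ) : unitExp (k * x) = unitExp x ^ k := by
  rw [unitExp, unitExp, ← Complex.exp_nat_mul]; congr 1; push_cast; ring

theorem unitExp_intCast (m : ℤ) : unitExp m = 1 := by
  rw [unitExp, Complex.exp_eq_one_iff]; exact ⟨m, by push_cast; ring⟩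

theorem unitExp_eq_one_iff (x : ℝ) : unitExp x = 1 ↔ ∃ m : ℤ, x = m := by
  refine ⟨fun h => ?_, by rintro ⟨m, rfl⟩; exact unitExp_intCast m⟩
  rw [unitExp, Complex.exp_eq_one_iff] at h
  obtain ⟨m, hm⟩ := h
  refine ⟨m, ?_⟩
  have h2 : (2 * Real.pi * Complex.I : ℂ) ≠ 0 := Complex.two_pi_I_ne_zero
  have : (x : ℂ) = m := mul_right_cancel₀ h2 (by linear_combination hm)
  exact_mod_cast this

@[fun_prop] theorem continuous_unitExp : Continuous unitExp := by unfold unitExp; fun_prop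

theorem unitExp_im (x : ℝ) : (unitExp x).im = Real.sin (2 * Real.pi * x) := by
  rw [unitExp_eq, mul_comm, Complex.exp_ofReal_mul_I_im]

theorem norm_unitExp_sub_one (x : ℝ) : ‖unitExp x - 1‖ = 2 * |Real.sin (Real.pi * x)| := by
  rw [unitExp_eq, Complex.norm_exp_I_mul_ofReal_sub_one, norm_mul, Real.norm_eq_abs,
    Real.norm_eq_abs, abs_of_pos two_pos]
  congr 3; ring

theorem integral_unitExp_int_mul (m : ℤ) :
    ∫ x in (0 : ℝ)..1, unitExp (m * x) = if m = 0 then 1 else 0 := by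
  split_ifs with h
  · simp [h]
  · have hc : (2 * Real.pi * m * Complex.I : ℂ) ≠ 0 := by
      simp [h, Real.pi_ne_zero, Complex.I_ne_zero]
    have h1 (x : ℝ) : unitExp (m * x) = Complex.exp ((2 * Real.pi * m * Complex.I) * x) := by
      rw [unitExp]; congr 1; push_cast; ring
    simp_rw [h1]
    rw [integral_exp_mul_complex hc]
    have h2 := unitExp_intCast m
    have h3 := h1 1
    rw [mul_one, h2] at h3
    rw [← h3]; simp

open ComplexConjugate in
theorem ofReal_norm_sum_unitExp_sq {ι : Type*} (s : Finset ι) (c : ι → ℂ) (m : ι → ℤ) (x : ℝ) :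
    ((‖∑ i ∈ s, c i * unitExp (m i * x)‖ ^ 2 : ℝ) : ℂ) =
      ∑ i ∈ s, ∑ j ∈ s, c i * conj (c j) * unitExp ((m i - m j : ℤ) * x) := by
  rw [← Complex.normSq_eq_norm_sq, ← Complex.mul_conj, map_sum, Finset.sum_mul_sum]
  refine Finset.sum_congr rfl fun i _ => Finset.sum_congr rfl fun j _ => ?_
  rw [map_mul, conj_unitExp]
  have : ((m i - m j : ℤ) : ℝ) * x = m i * x + -(m j * x) := by push_cast; ring
  rw [this, unitExp_add]; ring

/-- Parseval's identity for trigonometric polynomials. -/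
theorem integral_norm_sum_unitExp_sq {ι : Type*} (s : Finset ι) (c : ι → ℂ) {m : ι → ℤ}
    (hm : Function.Injective m) :
    ∫ x in (0 : ℝ)..1, ‖∑ i ∈ s, c i * unitExp (m i * x)‖ ^ 2 = ∑ i ∈ s, ‖c i‖ ^ 2 := by
  classical
  apply Complex.ofReal_injective
  rw [← intervalIntegral.integral_ofReal]
  simp_rw [ofReal_norm_sum_unitExp_sq]
  rw [intervalIntegral.integral_finsetSum fun i _ =>
    (Continuous.intervalIntegrable (by fun_prop) _ _)]
  rw [Complex.ofReal_sum]
  refine Finset.sum_congr rfl fun i hi => ?_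
  rw [intervalIntegral.integral_finsetSum fun i _ =>
    (Continuous.intervalIntegrable (by fun_prop) _ _)]
  simp_rw [intervalIntegral.integral_const_mul, integral_unitExp_int_mul, sub_eq_zero, hm.eq_iff]
  simp [hi, Complex.mul_conj, Complex.normSq_eq_norm_sq]

/-- Orthogonality of characters over the shifted `N`-th division points of the circle. -/
theorem sum_unitExp_sub_div {N : ℕ} (hN : 0 < N) (m : ℤ) (hm : |m| < N) (x : ℝ) :
    ∑ j ∈ Finset.range N, unitExp (m * (x - (j + 1) / N)) = if m = 0 then (N : ℂ) else 0 := by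
  split_ifs with h
  · simp [h]
  have hN' : (N : ℝ) ≠ 0 := by positivity
  have h1 (j : ℕ) : unitExp (m * (x - (j + 1) / N)) =
      unitExp (m * (x - 1 / N)) * unitExp (-(m / N)) ^ j := by
    rw [← unitExp_nat_mul, ← unitExp_add]; congr 1; field_simp; ring
  simp_rw [h1, ← Finset.mul_sum]
  -- The bound `|m| < N` enters here: the ratio is a nontrivial `N`-th root of unity, so the
  -- geometric sum vanishes.
  have hr : unitExp (-(m / N : ℝ)) ≠ 1 := by
    rw [Ne, unitExp_eq_one_iff]
    rintro ⟨k, hk⟩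
    have hk' : m = -k * N := by
      have : (m : ℝ) = -k * N := by rw [← hk]; field_simp
      exact_mod_cast this
    have : (N : ℤ) ∣ m := ⟨-k, by rw [hk']; ring⟩
    exact h (Int.eq_zero_of_abs_lt_dvd this hm)
  rw [geom_sum_eq hr, ← unitExp_nat_mul]
  have : (N : ℝ) * -(m / N) = (-m : ℤ) := by push_cast; field_simp
  rw [this, unitExp_intCast]; simp

/-! ### Fejér and conjugate Dirichlet kernels -/

/-- The Fejér kernel of degree `N - 1`, normalised to the value `1` at `0`. -/
noncomputable def fejer (N : ℕ) (x : ℝ) : ℝ :=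
  ‖∑ k ∈ Finset.range N, (1 : ℂ) * unitExp ((k : ℤ) * x)‖ ^ 2 / N ^ 2

/-- The conjugate Dirichlet kernel of degree `N - 1`. -/
noncomputable def conjDirichlet (N : ℕ) (x : ℝ) : ℝ :=
  ∑ k ∈ Finset.range N, Real.sin (2 * Real.pi * (k * x))

theorem fejer_eq {N : ℕ} {x : ℝ} (hx : Real.sin (Real.pi * x) ≠ 0) :
    fejer N x = Real.sin (Real.pi * (N * x)) ^ 2 / (N ^ 2 * Real.sin (Real.pi * x) ^ 2) := by
  have h1 : unitExp x ≠ 1 := fun h => hx <| by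
    have := norm_unitExp_sub_one x
    rw [h] at this
    simpa using this.symm
  have h2 : ∑ k ∈ Finset.range N, (1 : ℂ) * unitExp ((k : ℤ) * x) =
      (unitExp (N * x) - 1) / (unitExp x - 1) := by
    rw [unitExp_nat_mul, ← geom_sum_eq h1]
    refine Finset.sum_congr rfl fun k _ => ?_
    rw [← unitExp_nat_mul]; simp
  rw [fejer, h2, norm_div, norm_unitExp_sub_one, norm_unitExp_sub_one, div_pow, mul_pow, mul_pow,
    sq_abs, sq_abs, mul_div_mul_left _ _ (by norm_num), div_div, mul_comm ((N : ℝ) ^ 2)]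

/-- Away from the integers this is the closed form `sin²(πNx) cot(πx) - sin(πNx) cos(πNx)`. Only the
cotangent changes under `x ↦ x - j/N`, which makes sums over the nodes tractable. -/
theorem conjDirichlet_mul_sin (N : ℕ) (x : ℝ) :
    conjDirichlet N x * Real.sin (Real.pi * x) =
      Real.sin (Real.pi * (N * x)) ^ 2 * Real.cos (Real.pi * x) -
      Real.sin (Real.pi * (N * x)) * Real.cos (Real.pi * (N * x)) * Real.sin (Real.pi * x) := by
  induction N with
  | zero => simp [conjDirichlet]
  | succ N ih =>
    rw [conjDirichlet, Finset.sum_range_succ, ← conjDirichlet, add_mul, ih]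
    have h1 : 2 * Real.pi * (N * x) = 2 * (Real.pi * (N * x)) := by ring
    have h2 : Real.pi * ((N + 1 : ℕ) * x) = Real.pi * (N * x) + Real.pi * x := by push_cast; ring
    rw [h1, h2, Real.sin_two_mul, Real.sin_add, Real.cos_add]
    set S := Real.sin (Real.pi * (N * x))
    set K := Real.cos (Real.pi * (N * x))
    set s := Real.sin (Real.pi * x)
    set k := Real.cos (Real.pi * x)
    have hs : s ^ 2 + k ^ 2 = 1 := Real.sin_sq_add_cos_sq _
    linear_combination (-S * K * s - S ^ 2 * k) * hs

theorem abs_natCast_sub_lt {N k l : ℕ} (hk : k < N) (hl : l < N) : |(k : ℤ) - l| < N := by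
  rw [abs_lt]; omega

theorem ofReal_fejer (N : ℕ) (x : ℝ) : (fejer N x : ℂ) =
    (1 / N ^ 2 : ℂ) * ∑ k ∈ Finset.range N, ∑ l ∈ Finset.range N, unitExp ((k - l : ℤ) * x) := by
  have h := ofReal_norm_sum_unitExp_sq (Finset.range N) (fun _ => 1) (fun k : ℕ => (k : ℤ)) x
  rw [fejer, Complex.ofReal_div]
  rw [h]
  simp only [map_one, one_mul]
  push_cast
  ring

/-- All frequencies are below `N` in absolute value, so averaging over `N` equally spaced nodes
retains only the constant term. The kernels form a partition of unity. -/
theorem sum_fejer_sub_div {N : ℕ} (hN : 0 < N) (x : ℝ) :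
    ∑ j ∈ Finset.range N, fejer N (x - (j + 1) / N) = 1 := by
  apply Complex.ofReal_injective
  rw [Complex.ofReal_sum]
  simp_rw [ofReal_fejer]
  rw [← Finset.mul_sum, Finset.sum_comm]
  have h1 (k : ℕ) (hk : k ∈ Finset.range N) : ∑ j ∈ Finset.range N, ∑ l ∈ Finset.range N,
      unitExp ((k - l : ℤ) * (x - (j + 1) / N)) = N := by
    rw [Finset.sum_comm]
    have h2 (l : ℕ) (hl : l ∈ Finset.range N) : ∑ j ∈ Finset.range N,
        unitExp ((k - l : ℤ) * (x - (j + 1) / N)) = if k = l then (N : ℂ) else 0 := by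
      rw [sum_unitExp_sub_div hN _
        (abs_natCast_sub_lt (Finset.mem_range.1 hk) (Finset.mem_range.1 hl))]
      simp [sub_eq_zero]
    rw [Finset.sum_congr rfl h2, Finset.sum_ite_eq, if_pos hk]
  rw [Finset.sum_congr rfl h1]
  have hN' : (N : ℂ) ≠ 0 := by exact_mod_cast hN.ne'
  simp
  field_simp

theorem sum_conjDirichlet_sub_div {N : ℕ} (hN : 0 < N) (x : ℝ) :
    ∑ j ∈ Finset.range N, conjDirichlet N (x - (j + 1) / N) = 0 := by
  simp_rw [conjDirichlet]
  rw [Finset.sum_comm]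
  refine Finset.sum_eq_zero fun k hk => ?_
  simp_rw [← unitExp_im, ← Complex.im_sum]
  have h := sum_unitExp_sub_div hN (k : ℤ)
    (by simpa using Finset.mem_range.1 hk) x
  simp only [Int.cast_natCast] at h
  rw [h]
  split_ifs <;> simp

/-! ### Convexity of `-t cot t` -/

theorem mul_cos_le_sin {t : ℝ} (h0 : 0 ≤ t) (h1 : t ≤ Real.pi) : t * Real.cos t ≤ Real.sin t := by
  rcases le_or_gt (Real.cos t) 0 with h | h
  · exact (mul_nonpos_of_nonneg_of_nonpos h0 h).trans (Real.sin_nonneg_of_nonneg_of_le_pi h0 h1)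
  · have ht : t < Real.pi / 2 := by
      by_contra! h2
      exact absurd (Real.cos_nonpos_of_pi_div_two_le_of_le h2 (by linarith [Real.pi_pos])) (by linarith)
    have := Real.le_tan h0 ht
    rwa [Real.tan_eq_sin_div_cos, le_div_iff₀ h] at this

/-- `t ↦ 1/t - cot t` is monotone on `(0, π)`. -/
theorem monotoneOn_inv_sub_cot :
    MonotoneOn (fun t : ℝ => t⁻¹ - Real.cos t / Real.sin t) (Set.Ioo 0 Real.pi) := by
  have hd (t : ℝ) (ht : t ∈ Set.Ioo 0 Real.pi) :
      HasDerivAt (fun t : ℝ => t⁻¹ - Real.cos t / Real.sin t)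
        (-(t ^ 2)⁻¹ - (-Real.sin t * Real.sin t - Real.cos t * Real.cos t) / Real.sin t ^ 2) t :=
    (hasDerivAt_inv ht.1.ne').sub
      ((Real.hasDerivAt_cos t).div (Real.hasDerivAt_sin t) (Real.sin_pos_of_mem_Ioo ht).ne')
  refine monotoneOn_of_hasDerivWithinAt_nonneg (convex_Ioo _ _)
    (fun t ht => (hd t ht).continuousAt.continuousWithinAt)
    (fun t ht => (hd t (interior_subset ht)).hasDerivWithinAt) fun t ht => ?_
  replace ht := interior_subset ht
  have hs := Real.sin_pos_of_mem_Ioo ht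
  have h1 : -Real.sin t * Real.sin t - Real.cos t * Real.cos t = -1 := by
    linear_combination -Real.sin_sq_add_cos_sq t
  rw [h1, neg_div, one_div, sub_neg_eq_add, neg_add_eq_sub, sub_nonneg]
  have := Real.sin_le ht.1.le
  gcongr

/-- The tangent line inequality for the convex function `t ↦ -t cot t` on `(-π, π)`, for increments
to the right. -/
theorem tangent_le_mul_cot {y d : ℝ} (hd : 0 < d) (hy0 : y ≠ 0) (hx0 : y + d ≠ 0)
    (hy : -Real.pi < y) (hx : y + d < Real.pi) (hdpi : d < Real.pi) :
    d * (y / Real.sin y ^ 2 - Real.cos y / Real.sin y) ≤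
      -((y + d) * (Real.cos (y + d) / Real.sin (y + d))) + y * (Real.cos y / Real.sin y) := by
  have hsd : 0 < Real.sin d := Real.sin_pos_of_mem_Ioo ⟨hd, hdpi⟩
  let g : ℝ → ℝ := fun t => t⁻¹ - Real.cos t / Real.sin t
  have hg0 (t : ℝ) (ht : t ∈ Set.Ioo 0 Real.pi) : 0 ≤ g t := by
    have := mul_cos_le_sin ht.1.le ht.2.le
    have h1 := ht.1
    rw [sub_nonneg, div_le_iff₀ (Real.sin_pos_of_mem_Ioo ht), inv_mul_eq_div, le_div_iff₀ h1]
    linarith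
  have hgneg (t : ℝ) : g (-t) = -g t := by
    simp only [g, Real.cos_neg, Real.sin_neg, inv_neg, div_neg]; ring
  have hsy : 0 < y * Real.sin y := by
    rcases lt_or_gt_of_ne hy0 with h | h
    · exact mul_pos_of_neg_of_neg h (Real.sin_neg_of_neg_of_neg_pi_lt h hy)
    · exact mul_pos h (Real.sin_pos_of_mem_Ioo ⟨h, by linarith⟩)
  have hsy0 : Real.sin y ≠ 0 := fun h => by simp [h] at hsy
  -- As `g` is odd and increasing, `g y + g d = g d - g (-y)` has the sign of `y + d`, which is also
  -- the sign of `sin (y + d)`.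
  have hmain : 0 ≤ (g y + g d) / Real.sin (y + d) := by
    rcases lt_or_gt_of_ne hx0 with h | h
    · have hs := Real.sin_neg_of_neg_of_neg_pi_lt h (by linarith)
      refine div_nonneg_of_nonpos ?_ hs.le
      have := monotoneOn_inv_sub_cot (a := d) (b := -y) ⟨hd, hdpi⟩ ⟨by linarith, by linarith⟩
        (by linarith)
      change g d ≤ g (-y) at this
      rw [hgneg] at this; linarith
    · have hs := Real.sin_pos_of_mem_Ioo ⟨h, hx⟩
      refine div_nonneg ?_ hs.le
      rcases lt_or_gt_of_ne hy0 with h' | h'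
      · have := monotoneOn_inv_sub_cot (a := -y) (b := d) ⟨by linarith, by linarith⟩ ⟨hd, hdpi⟩
          (by linarith)
        change g (-y) ≤ g d at this
        rw [hgneg] at this; linarith
      · exact add_nonneg (hg0 _ ⟨h', by linarith⟩) (hg0 _ ⟨hd, hdpi⟩)
  have hsx0 : Real.sin (y + d) ≠ 0 := by
    rcases lt_or_gt_of_ne hx0 with h | h
    · exact (Real.sin_neg_of_neg_of_neg_pi_lt h (by linarith)).ne
    · exact (Real.sin_pos_of_mem_Ioo ⟨h, hx⟩).ne'
  have hnn : 0 ≤ (g y + g d) / Real.sin (y + d) * (y * Real.sin y) * (d * Real.sin d) /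
    Real.sin y ^ 2 := by positivity
  -- The gap in the tangent inequality is exactly this product, by the addition formulas.
  have key : (g y + g d) / Real.sin (y + d) * (y * Real.sin y) * (d * Real.sin d) /
      Real.sin y ^ 2 = -((y + d) * (Real.cos (y + d) / Real.sin (y + d)))
        + y * (Real.cos y / Real.sin y) -
        d * (y / Real.sin y ^ 2 - Real.cos y / Real.sin y) := by
    have e1 : Real.sin d = Real.sin (y + d) * Real.cos y - Real.cos (y + d) * Real.sin y := by
      rw [← Real.sin_sub]; congr 1; ring
    have e2 : Real.cos y * Real.sin d + Real.cos d * Real.sin y = Real.sin (y + d) := by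
      rw [Real.sin_add]; ring
    have e3 : (g y + g d) * (y * Real.sin y) * (d * Real.sin d) =
        (y + d) * Real.sin y * Real.sin d - y * d * Real.sin (y + d) := by
      simp only [g]; field_simp; linear_combination (-(y * d)) * e2
    have e4 : (g y + g d) / Real.sin (y + d) * (y * Real.sin y) * (d * Real.sin d) =
      ((y + d) * Real.sin y * Real.sin d - y * d * Real.sin (y + d)) / Real.sin (y + d) := by
      rw [← e3]; ring
    rw [e4]
    field_simp
    linear_combination ((y + d) * Real.sin y) * e1
  linarith

/-! ### The sawtooth majorant -/

/-- A trigonometric polynomial of degree `N - 1` and mean `1 / (2N)` that majorises the sawtooth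
function `x - ⌊x⌋ - 1/2`. -/
noncomputable def sawMajorant (N : ℕ) (x : ℝ) : ℝ :=
  ∑ j ∈ Finset.range N, ((j + 1) / N - 1 / 2) * fejer N (x - (j + 1) / N) -
    conjDirichlet N x / (Real.pi * N)

@[fun_prop] theorem continuous_fejer (N : ℕ) : Continuous (fejer N) := by
  unfold fejer; fun_prop

@[fun_prop] theorem continuous_conjDirichlet (N : ℕ) : Continuous (conjDirichlet N) := by
  unfold conjDirichlet; fun_prop

@[fun_prop] theorem continuous_sawMajorant (N : ℕ) : Continuous (sawMajorant N) := by
  unfold sawMajorant; fun_prop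

/-- The gap is a nonnegative factor times a sum, over consecutive nodes, of tangent-line errors of
the convex function `-t cot t`. Off the nodes every cotangent is finite. -/
theorem sawMajorant_ge_of_forall_ne {N : ℕ} (hN : 2 ≤ N) {x : ℝ} (hx0 : 0 < x) (hx1 : x < 1)
    (hx : ∀ m : ℤ, x ≠ m / N) : x - 1 / 2 ≤ sawMajorant N x := by
  have hNpos : (0 : ℝ) < N := by positivity
  have hπ := Real.pi_pos
  have hsin {t : ℝ} (ht : ∀ m : ℤ, t ≠ m) : Real.sin (Real.pi * t) ≠ 0 := by
    rw [Real.sin_ne_zero_iff]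
    intro m hm
    exact ht m (mul_left_cancel₀ hπ.ne' (by rw [← hm]; ring))
  let u : ℕ → ℝ := fun j => x - j / N
  have hu (j : ℕ) (m : ℤ) : u j ≠ m := fun h => hx (j + m * N) <| by
    simp only [u, sub_eq_iff_eq_add] at h
    rw [h]; push_cast; field_simp; ring
  have hsu (j : ℕ) : Real.sin (Real.pi * u j) ≠ 0 := hsin (hu j)
  have hsx : Real.sin (Real.pi * x) ≠ 0 := by simpa [u] using hsu 0
  set w := Real.sin (Real.pi * (N * x)) ^ 2 with hw
  set c := Real.sin (Real.pi * (N * x)) * Real.cos (Real.pi * (N * x)) with hc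
  have harg (j : ℕ) : Real.pi * (N * u j) = Real.pi * (N * x) - j * Real.pi := by
    simp only [u]; field_simp
  -- Shifting by `j/N` multiplies the sine and cosine of `πNx` by `(-1)^j`, so `w` and `c` are the
  -- same at every node.
  have hpm (j : ℕ) : ((-1 : ℝ) ^ j) * (-1) ^ j = 1 := by rw [← mul_pow]; simp
  have hw' (j : ℕ) : Real.sin (Real.pi * (N * u j)) ^ 2 = w := by
    rw [harg, Real.sin_sub_nat_mul_pi, hw]; linear_combination Real.sin (Real.pi * (N * x)) ^ 2 * hpm j
  have hc' (j : ℕ) : Real.sin (Real.pi * (N * u j)) * Real.cos (Real.pi * (N * u j)) = c := by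
    rw [harg, Real.sin_sub_nat_mul_pi, Real.cos_sub_nat_mul_pi, hc]
    linear_combination Real.sin (Real.pi * (N * x)) * Real.cos (Real.pi * (N * x)) * hpm j
  let cot : ℝ → ℝ := fun t => Real.cos t / Real.sin t
  have hF (j : ℕ) : fejer N (u j) = w / (N ^ 2 * Real.sin (Real.pi * u j) ^ 2) := by
    rw [fejer_eq (hsu j), hw']
  have hC (j : ℕ) : conjDirichlet N (u j) = w * cot (Real.pi * u j) - c := by
    have := conjDirichlet_mul_sin N (u j)
    rw [hw', hc'] at this
    have h2 := hsu j
    simp only [cot]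
    field_simp
    linear_combination this
  have hu1 (j : ℕ) : x - (j + 1) / N = u (j + 1) := by simp [u]
  have hsumF := sum_fejer_sub_div (by omega : 0 < N) x
  have hsumC := sum_conjDirichlet_sub_div (by omega : 0 < N) x
  simp_rw [hu1] at hsumF hsumC
  have hux : u 0 = x := by simp [u]
  have hCx := hC 0
  rw [hux] at hCx
  let E : ℕ → ℝ := fun j => -(Real.pi * u j * cot (Real.pi * u j))
  -- Tangent line at `πu_{j+1}`, increment `π/N`; `N ≥ 2` makes the increment smaller than `π`.
  have hstep (j : ℕ) (hj : j < N) : 0 ≤ E j - E (j + 1) -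
      Real.pi / N * (Real.pi * u (j + 1) / Real.sin (Real.pi * u (j + 1)) ^ 2
        - cot (Real.pi * u (j + 1))) := by
    have hsucc : Real.pi * u (j + 1) + Real.pi / N = Real.pi * u j := by
      simp only [u]; push_cast; field_simp; ring
    have hj' : ((j : ℝ) + 1) / N ≤ 1 := by
      rw [div_le_one hNpos]; exact_mod_cast hj
    have hj0 : 0 ≤ (j : ℝ) / N := by positivity
    have hne (i : ℕ) : Real.pi * u i ≠ 0 := mul_ne_zero hπ.ne' (by simpa using hu i 0)
    have := tangent_le_mul_cot (y := Real.pi * u (j + 1)) (d := Real.pi / N) (by positivity)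
      (hne _) (by rw [hsucc]; exact hne _) (by simp only [u]; push_cast; nlinarith)
      (by rw [hsucc]; simp only [u]; nlinarith)
      (div_lt_self hπ (by exact_mod_cast hN))
    rw [hsucc] at this
    simp only [E, cot]
    linarith
  have hsum := Finset.sum_nonneg fun j hj => hstep j (Finset.mem_range.1 hj)
  rw [Finset.sum_sub_distrib, Finset.sum_range_sub' E, ← Finset.mul_sum] at hsum
  -- Since `u N = u 0 - 1` and the cotangent has period `π`, the telescoped sum leaves a single
  -- cotangent.
  have hEE : E 0 - E N = -(Real.pi * cot (Real.pi * x)) := by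
    have hN1 : u N = x - 1 := by simp [u, hNpos.ne']
    have h1 : cot (Real.pi * (x - 1)) = cot (Real.pi * x) := by
      simp only [cot]; rw [mul_sub, mul_one, Real.sin_sub_pi, Real.cos_sub_pi, neg_div_neg_eq]
    simp only [E]
    rw [hN1, h1, hux]; ring
  rw [hEE] at hsum
  set A := ∑ j ∈ Finset.range N, (Real.pi * u (j + 1) / Real.sin (Real.pi * u (j + 1)) ^ 2
        - cot (Real.pi * u (j + 1))) with hA
  have hid : sawMajorant N x - (x - 1 / 2) = w / (Real.pi ^ 2 * N) *
      (-(Real.pi * cot (Real.pi * x)) - Real.pi / N * A) := by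
    -- Two sums are inserted: `x - 1/2` times the partition of unity, and a multiple of the
    -- vanishing sum of `conjDirichlet`. The weight `1/(πN²)` completes each Fejér term to a
    -- derivative of `-t cot t`, and its `c` terms cancel that of `conjDirichlet N x`.
    have h1 : sawMajorant N x - (x - 1 / 2) =
        ∑ j ∈ Finset.range N, (((j + 1) / N - 1 / 2) * fejer N (u (j + 1))
          - (x - 1 / 2) * fejer N (u (j + 1)) + 1 / (Real.pi * N ^ 2) * conjDirichlet N (u (j + 1)))
          - conjDirichlet N x / (Real.pi * N) := by
      rw [Finset.sum_add_distrib, Finset.sum_sub_distrib, ← Finset.mul_sum, ← Finset.mul_sum,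
        hsumF, hsumC, sawMajorant]
      simp_rw [hu1]
      ring
    have h2 (j : ℕ) : ((j + 1) / N - 1 / 2) * fejer N (u (j + 1))
          - (x - 1 / 2) * fejer N (u (j + 1)) + 1 / (Real.pi * N ^ 2) * conjDirichlet N (u (j + 1)) =
        -(w / (Real.pi * N ^ 2)) * (Real.pi * u (j + 1) / Real.sin (Real.pi * u (j + 1)) ^ 2
        - cot (Real.pi * u (j + 1))) - c / (Real.pi * N ^ 2) := by
      have h3 : ((j : ℝ) + 1) / N = x - u (j + 1) := by simp [u]
      rw [hC, hF, h3]
      have := hsu (j + 1)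
      field_simp
      ring
    rw [h1, Finset.sum_congr rfl fun j _ => h2 j, Finset.sum_sub_distrib, ← Finset.mul_sum, ← hA,
      hCx, Finset.sum_const, Finset.card_range, nsmul_eq_mul]
    field_simp
    ring
  have hw0 : 0 ≤ w := sq_nonneg _
  have : 0 ≤ sawMajorant N x - (x - 1 / 2) := by rw [hid]; positivity
  linarith

/-- The excluded nodes are countable, so density and continuity extend the bound to the closed
interval, endpoints included. -/
theorem sawMajorant_ge {N : ℕ} (hN : 2 ≤ N) {x : ℝ} (hx : x ∈ Set.Icc (0 : ℝ) 1) :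
    x - 1 / 2 ≤ sawMajorant N x := by
  have hcount : (Set.range fun m : ℤ => (m / N : ℝ)).Countable := Set.countable_range _
  have hd := hcount.dense_compl ℝ
  have hcl : Set.Icc (0 : ℝ) 1 ⊆ closure (Set.Ioo 0 1 ∩ (Set.range fun m : ℤ => (m / N : ℝ))ᶜ) := by
    rw [← closure_Ioo (zero_ne_one' ℝ)]
    exact closure_minimal (hd.open_subset_closure_inter isOpen_Ioo) isClosed_closure
  refine le_on_closure (f := fun x => x - 1 / 2) (g := sawMajorant N) (fun y hy => ?_)
    (by fun_prop) (by fun_prop) (hcl hx)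
  exact sawMajorant_ge_of_forall_ne hN hy.1.1 hy.1.2 fun m hm => hy.2 ⟨m, hm.symm⟩

/-! ### Spaces of trigonometric polynomials -/

/-- The space of trigonometric polynomials of degree at most `d`. -/
noncomputable def trigSpace (d : ℕ) : Submodule ℂ (ℝ → ℂ) :=
  Submodule.span ℂ ((fun (k : ℤ) (x : ℝ) => unitExp (k * x)) '' {k | |k| ≤ d})

theorem unitExp_mem_trigSpace {d : ℕ} {k : ℤ} (hk : |k| ≤ d) :
    (fun x : ℝ => unitExp (k * x)) ∈ trigSpace d :=
  Submodule.subset_span ⟨k, hk, rfl⟩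

theorem const_mem_trigSpace (d : ℕ) (c : ℂ) : (fun _ : ℝ => c) ∈ trigSpace d := by
  have := (trigSpace d).smul_mem c (unitExp_mem_trigSpace (d := d) (k := 0) (by simp))
  convert this using 1
  ext; simp

theorem comp_sub_mem_trigSpace {d : ℕ} {f : ℝ → ℂ} (hf : f ∈ trigSpace d) (c : ℝ) :
    (fun x => f (x - c)) ∈ trigSpace d := by
  refine Submodule.span_induction (p := fun f _ => (fun x => f (x - c)) ∈ trigSpace d)
    ?_ ?_ ?_ ?_ hf
  · rintro _ ⟨k, hk, rfl⟩
    convert (trigSpace d).smul_mem (unitExp (k * -c)) (unitExp_mem_trigSpace hk) using 1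
    ext x
    rw [Pi.smul_apply, smul_eq_mul, ← unitExp_add]
    ring_nf
  · exact (trigSpace d).zero_mem
  · intro f g _ _ hf hg
    exact (trigSpace d).add_mem hf hg
  · intro a f _ hf
    exact (trigSpace d).smul_mem a hf

theorem comp_neg_mem_trigSpace {d : ℕ} {f : ℝ → ℂ} (hf : f ∈ trigSpace d) :
    (fun x => f (-x)) ∈ trigSpace d := by
  refine Submodule.span_induction (p := fun f _ => (fun x => f (-x)) ∈ trigSpace d)
    ?_ ?_ ?_ ?_ hf
  · rintro _ ⟨k, hk, rfl⟩
    convert unitExp_mem_trigSpace (d := d) (k := -k) (by simpa using hk) using 1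
    ext x
    push_cast; ring_nf
  · exact (trigSpace d).zero_mem
  · intro f g _ _ hf hg
    exact (trigSpace d).add_mem hf hg
  · intro a f _ hf
    exact (trigSpace d).smul_mem a hf

theorem periodic_of_mem_trigSpace {d : ℕ} {f : ℝ → ℂ} (hf : f ∈ trigSpace d) :
    Function.Periodic f 1 := by
  refine Submodule.span_induction (p := fun f _ => Function.Periodic f 1) ?_ ?_ ?_ ?_ hf
  · rintro _ ⟨k, -, rfl⟩ x
    simp only [mul_add, mul_one, unitExp_add, unitExp_intCast]
  · intro x; rfl
  · intro f g _ _ hf hg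
    exact hf.add hg
  · intro a f _ hf
    exact hf.smul a

open Polynomial ComplexConjugate in
theorem exists_polynomial_of_mem_trigSpace {d : ℕ} {f : ℝ → ℂ} (hf : f ∈ trigSpace d) :
    ∃ p : ℂ[X], p.natDegree ≤ 2 * d ∧ ∀ x, f x = p.eval (unitExp x) * conj (unitExp x) ^ d := by
  refine Submodule.span_induction (p := fun f _ => ∃ p : ℂ[X], p.natDegree ≤ 2 * d ∧
    ∀ x, f x = p.eval (unitExp x) * conj (unitExp x) ^ d) ?_ ?_ ?_ ?_ hf
  · rintro _ ⟨k, hk, rfl⟩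
    rw [Set.mem_ofPred_eq, abs_le] at hk
    obtain ⟨m, hm⟩ := Int.eq_ofNat_of_zero_le (by omega : 0 ≤ k + d)
    refine ⟨X ^ m, by rw [natDegree_X_pow]; omega, fun x => ?_⟩
    rw [eval_pow, eval_X, ← unitExp_nat_mul, conj_unitExp, ← unitExp_nat_mul, ← unitExp_add]
    have : (k : ℝ) = m - d := by
      have : k = m - d := by omega
      rw [this]; push_cast; ring
    simp only [this]
    ring_nf
  · exact ⟨0, by simp, by simp⟩
  · rintro f g _ _ ⟨p, hp, hpe⟩ ⟨q, hq, hqe⟩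
    refine ⟨p + q, (natDegree_add_le _ _).trans (max_le hp hq), fun x => ?_⟩
    rw [Pi.add_apply, hpe, hqe, eval_add]; ring
  · rintro a f _ ⟨p, hp, hpe⟩
    refine ⟨C a * p, (natDegree_C_mul_le _ _).trans hp, fun x => ?_⟩
    rw [Pi.smul_apply, hpe, eval_mul, eval_C, smul_eq_mul]; ring

theorem fejer_mem_trigSpace (d : ℕ) : (fun x => (fejer (d + 1) x : ℂ)) ∈ trigSpace d := by
  simp_rw [ofReal_fejer]
  have : (∑ k ∈ Finset.range (d + 1), ∑ l ∈ Finset.range (d + 1),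
      fun x : ℝ => unitExp ((k - l : ℤ) * x)) ∈ trigSpace d :=
    Submodule.sum_mem _ fun k hk => Submodule.sum_mem _ fun l hl => unitExp_mem_trigSpace <| by
      have := abs_natCast_sub_lt (Finset.mem_range.1 hk) (Finset.mem_range.1 hl)
      push_cast at this
      omega
  convert (trigSpace d).smul_mem (1 / (d + 1 : ℕ) ^ 2 : ℂ) this using 1
  ext x
  simp [Finset.sum_apply]

theorem conjDirichlet_mem_trigSpace (d : ℕ) :
    (fun x => (conjDirichlet (d + 1) x : ℂ)) ∈ trigSpace d := by
  have : (∑ k ∈ Finset.range (d + 1), (1 / (2 * Complex.I)) • ((fun x : ℝ => unitExp ((k : ℤ) * x))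
      - fun x : ℝ => unitExp ((-k : ℤ) * x))) ∈ trigSpace d :=
    Submodule.sum_mem _ fun k hk => Submodule.smul_mem _ _ <| by
      have := Finset.mem_range.1 hk
      exact Submodule.sub_mem _ (unitExp_mem_trigSpace (by rw [abs_le]; omega))
        (unitExp_mem_trigSpace (by rw [abs_le]; omega))
  convert this using 1
  ext x
  rw [conjDirichlet, Complex.ofReal_sum, Finset.sum_apply]
  refine Finset.sum_congr rfl fun k _ => ?_
  have h1 : ((-k : ℤ) : ℝ) * x = -(k * x) := by push_cast; ring
  have h2 := Complex.sub_conj (unitExp (k * x))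
  rw [unitExp_im, conj_unitExp] at h2
  simp only [Pi.smul_apply, Pi.sub_apply, smul_eq_mul]
  rw [h1, Int.cast_natCast, h2]
  have := Complex.I_ne_zero
  push_cast
  field_simp

theorem sawMajorant_mem_trigSpace (d : ℕ) :
    (fun x => (sawMajorant (d + 1) x : ℂ)) ∈ trigSpace d := by
  have h1 : (∑ j ∈ Finset.range (d + 1), ((((j + 1) / (d + 1 : ℕ) - 1 / 2 : ℝ)) : ℂ) •
      fun x : ℝ => (fejer (d + 1) (x - (j + 1) / (d + 1 : ℕ)) : ℂ)) ∈ trigSpace d :=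
    Submodule.sum_mem _ fun j _ => Submodule.smul_mem _ _ <|
      comp_sub_mem_trigSpace (fejer_mem_trigSpace d) _
  have h2 := (trigSpace d).smul_mem (((Real.pi * (d + 1 : ℕ))⁻¹ : ℝ) : ℂ)
    (conjDirichlet_mem_trigSpace d)
  convert (trigSpace d).sub_mem h1 h2 using 1
  ext x
  rw [sawMajorant, Pi.sub_apply, Finset.sum_apply, Complex.ofReal_sub, Complex.ofReal_sum]
  congr 1
  · refine Finset.sum_congr rfl fun j _ => ?_
    rw [Pi.smul_apply, smul_eq_mul, ← Complex.ofReal_mul]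
  · rw [Pi.smul_apply, smul_eq_mul, ← Complex.ofReal_mul, div_eq_inv_mul]

theorem periodic_of_ofReal_mem_trigSpace {d : ℕ} {f : ℝ → ℝ}
    (hf : (fun x => (f x : ℂ)) ∈ trigSpace d) : Function.Periodic f 1 := fun x =>
  Complex.ofReal_injective (periodic_of_mem_trigSpace hf x)

/-! ### Means over a period -/

theorem Function.Periodic.intervalIntegral_comp_sub {f : ℝ → ℝ} (hf : Function.Periodic f 1)
    (c : ℝ) : ∫ x in (0 : ℝ)..1, f (x - c) = ∫ x in (0 : ℝ)..1, f x := by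
  rw [intervalIntegral.integral_comp_sub_right (fun x => f x)]
  have := hf.intervalIntegral_add_eq (0 - c) 0
  rw [zero_add] at this
  rw [← this]; congr 1; ring

theorem Function.Periodic.intervalIntegral_comp_neg {f : ℝ → ℝ} (hf : Function.Periodic f 1) :
    ∫ x in (0 : ℝ)..1, f (-x) = ∫ x in (0 : ℝ)..1, f x := by
  rw [intervalIntegral.integral_comp_neg (fun x => f x)]
  have := hf.intervalIntegral_add_eq (-1) 0
  rw [zero_add] at this
  rw [← this]; simp

theorem integral_fejer (d : ℕ) : ∫ x in (0 : ℝ)..1, fejer (d + 1) x = 1 / (d + 1) := by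
  unfold fejer
  rw [intervalIntegral.integral_div, integral_norm_sum_unitExp_sq (Finset.range (d + 1))
    (fun _ => 1) (m := fun k : ℕ => (k : ℤ)) Nat.cast_injective]
  simp
  field_simp

theorem integral_conjDirichlet (N : ℕ) : ∫ x in (0 : ℝ)..1, conjDirichlet N x = 0 := by
  unfold conjDirichlet
  rw [intervalIntegral.integral_finsetSum fun k _ =>
    (Continuous.intervalIntegrable (by fun_prop) _ _)]
  refine Finset.sum_eq_zero fun k _ => ?_
  simp_rw [← unitExp_im]
  have h1 := Complex.imCLM.intervalIntegral_comp_comm (μ := volume) (a := 0) (b := 1)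
    (f := fun x : ℝ => unitExp (k * x)) (Continuous.intervalIntegrable (by fun_prop) _ _)
  have h2 := integral_unitExp_int_mul k
  rw [Int.cast_natCast] at h2
  rw [h2] at h1
  simp only [Complex.imCLM_apply] at h1
  rw [h1]; split_ifs <;> simp

theorem integral_sawMajorant (d : ℕ) :
    ∫ x in (0 : ℝ)..1, sawMajorant (d + 1) x = 1 / (2 * (d + 1)) := by
  have hper := periodic_of_ofReal_mem_trigSpace (fejer_mem_trigSpace d)
  unfold sawMajorant
  rw [intervalIntegral.integral_sub (Continuous.intervalIntegrable (by fun_prop) _ _)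
    (Continuous.intervalIntegrable (by fun_prop) _ _),
    intervalIntegral.integral_finsetSum fun k _ =>
      (Continuous.intervalIntegrable (by fun_prop) _ _),
    intervalIntegral.integral_div, integral_conjDirichlet]
  simp_rw [intervalIntegral.integral_const_mul, hper.intervalIntegral_comp_sub, integral_fejer]
  rw [← Finset.sum_mul, Finset.sum_sub_distrib, ← Finset.sum_div]
  have h : ∀ m : ℕ, ∑ j ∈ Finset.range m, ((j : ℝ) + 1) = m * (m + 1) / 2 := by
    intro m
    induction m with
    | zero => simp
    | succ m ih => rw [Finset.sum_range_succ, ih]; push_cast; ring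
  rw [h]
  have : (d : ℝ) + 1 ≠ 0 := by positivity
  simp
  field_simp
  ring

/-! ### The arc majorant -/

/-- The Selberg majorant of the arc `[0, β]` of the circle `ℝ/ℤ`, factored into squares: a sum of
squares of polynomials of degree less than `N` on the unit circle, at least `1` on the arc, and with
mean `β + 1/N`. -/
theorem exists_arc_majorant {N : ℕ} (hN : 2 ≤ N) {β : ℝ} (hβ0 : 0 ≤ β) (hβ1 : β ≤ 1) :
    ∃ (ι : Type) (_ : Fintype ι) (q : ι → ℕ → ℂ),
      (∀ x ∈ Set.Icc 0 β, 1 ≤ ∑ i, ‖∑ j ∈ Finset.range N, q i j * unitExp (j * x)‖ ^ 2) ∧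
      ∑ i, ∑ j ∈ Finset.range N, ‖q i j‖ ^ 2 = β + 1 / N := by
  obtain ⟨d, rfl⟩ : ∃ d, N = d + 1 := ⟨N - 1, by omega⟩
  set T := sawMajorant (d + 1) with hT
  have hTmem : (fun x => (T x : ℂ)) ∈ trigSpace d := sawMajorant_mem_trigSpace d
  have hTper : Function.Periodic T 1 := periodic_of_ofReal_mem_trigSpace hTmem
  -- With the sawtooth in place of `T`, this expression is the indicator of the arc away from its
  -- endpoints.
  let P : ℝ → ℝ := fun x => β + (T (x - β) + T (-x))
  have hPmem : (fun x => (P x : ℂ)) ∈ trigSpace d := by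
    have := (trigSpace d).add_mem (const_mem_trigSpace d β)
      ((trigSpace d).add_mem (comp_sub_mem_trigSpace hTmem β) (comp_neg_mem_trigSpace hTmem))
    convert this using 1
    ext x; simp [P]
  have hPper : Function.Periodic P 1 := periodic_of_ofReal_mem_trigSpace hPmem
  have hneg (x : ℝ) (hx : x ∈ Set.Icc (0 : ℝ) 1) : 1 / 2 - x ≤ T (-x) := by
    have h := sawMajorant_ge hN (x := -x + 1) ⟨by linarith [hx.2], by linarith [hx.1]⟩
    rw [← hT, hTper] at h
    linarith
  have hP1 (x : ℝ) (hx : x ∈ Set.Icc 0 β) : 1 ≤ P x := by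
    have h1 := sawMajorant_ge hN (x := x - β + 1) ⟨by linarith [hx.1], by linarith [hx.2]⟩
    rw [← hT, hTper] at h1
    have h2 := hneg x ⟨hx.1, hx.2.trans hβ1⟩
    simp only [P]
    linarith
  have hP0 (x : ℝ) : 0 ≤ P x := by
    have hfr : P x = P (Int.fract x) := by
      have := hPper.sub_int_mul_eq (x := x) ⌊x⌋
      rw [mul_one] at this
      rw [← this]; rfl
    rw [hfr]
    set y := Int.fract x
    have hy0 : 0 ≤ y := Int.fract_nonneg x
    have hy1 : y < 1 := Int.fract_lt_one x
    rcases le_or_gt y β with h | h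
    · exact zero_le_one.trans (hP1 y ⟨hy0, h⟩)
    · have h1 := sawMajorant_ge hN (x := y - β) ⟨by linarith, by linarith⟩
      have h2 := hneg y ⟨hy0, hy1.le⟩
      simp only [P, hT] at *
      linarith
  obtain ⟨p, hpd, hp⟩ := exists_polynomial_of_mem_trigSpace hPmem
  have hsurj (z : ℂ) (hz : ‖z‖ = 1) : ∃ x, unitExp x = z := by
    refine ⟨z.arg / (2 * Real.pi), ?_⟩
    have h := Complex.norm_mul_exp_arg_mul_I z
    rw [hz, Complex.ofReal_one, one_mul] at h
    rw [unitExp_eq, mul_comm Complex.I, mul_div_cancel₀ _ (by positivity), h]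
  obtain ⟨ι, hι, Q, hQd, hQ⟩ := exists_eval_eq_sum_sq_of_nonneg d p hpd fun z hz => by
    obtain ⟨x, rfl⟩ := hsurj z hz
    rw [← hp]
    exact Complex.zero_le_real.2 (hP0 x)
  have hPQ (x : ℝ) : P x = ∑ i, ‖∑ j ∈ Finset.range (d + 1),
      (Q i).coeff j * unitExp ((j : ℤ) * x)‖ ^ 2 := by
    apply Complex.ofReal_injective
    rw [hp, hQ _ (norm_unitExp x)]
    congr 1
    refine Finset.sum_congr rfl fun i _ => ?_
    rw [Polynomial.eval_eq_sum_range' (Nat.lt_succ_of_le (hQd i))]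
    simp_rw [← unitExp_nat_mul, Int.cast_natCast]
  refine ⟨ι, hι, fun i j => (Q i).coeff j, fun x hx => ?_, ?_⟩
  · have := hP1 x hx
    rw [hPQ] at this
    simpa using this
  -- By Parseval the sum of squared coefficients is the mean of `P`, namely `β + 2 · 1/(2N)`.
  · have h1 : ∫ x in (0 : ℝ)..1, P x = β + 1 / (d + 1 : ℕ) := by
      have hTc : Continuous T := continuous_sawMajorant _
      rw [intervalIntegral.integral_add (Continuous.intervalIntegrable (by fun_prop) _ _)
        (Continuous.intervalIntegrable (by fun_prop) _ _),
        intervalIntegral.integral_add (Continuous.intervalIntegrable (by fun_prop) _ _)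
        (Continuous.intervalIntegrable (by fun_prop) _ _), hTper.intervalIntegral_comp_sub,
        hTper.intervalIntegral_comp_neg, hT, integral_sawMajorant]
      have : (d : ℝ) + 1 ≠ 0 := by positivity
      simp
      field_simp
      norm_num
    rw [← h1]
    simp_rw [hPQ]
    rw [intervalIntegral.integral_finsetSum fun i _ =>
      (Continuous.intervalIntegrable (by fun_prop) _ _)]
    refine Finset.sum_congr rfl fun i _ => ?_
    rw [integral_norm_sum_unitExp_sq _ _ (m := fun k : ℕ => (k : ℤ)) Nat.cast_injective]

/-! ### Exponential sums and their translates -/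

/-- The exponential sum `∑ a_k e^{-2πiks}` over `k = 0, …, n-1`. -/
noncomputable def expSum {n : ℕ} (a : Fin n → ℂ) (s : ℝ) : ℂ :=
  ∑ k, a k * unitExp ((-(k : ℕ) : ℤ) * s)

@[fun_prop] theorem continuous_expSum {n : ℕ} (a : Fin n → ℂ) : Continuous (expSum a) := by
  unfold expSum; fun_prop

theorem expSum_add_one {n : ℕ} (a : Fin n → ℂ) (s : ℝ) : expSum a (s + 1) = expSum a s := by
  unfold expSum
  simp only [mul_add, mul_one, unitExp_add, unitExp_intCast]

theorem norm_trigPoly {n : ℕ} (φ : ℝ) (a : EuclideanSpace ℂ (Fin n)) (s : ℝ) :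
    ‖trigPoly φ a s‖ = ‖expSum a s‖ := by
  have h : trigPoly φ a s = unitExp φ * (unitExp (-s) * expSum a s) := by
    have h1 : unitExp φ = Complex.exp (2 * Real.pi * Complex.I * φ) := by
      rw [unitExp]; congr 1; ring
    rw [trigPoly, expSum, h1]
    congr 1
    · rw [Finset.mul_sum]
      refine Finset.sum_congr rfl fun k _ => ?_
      rw [mul_left_comm, ← unitExp_add, unitExp]
      congr 2; push_cast; ring
  rw [h, norm_mul, norm_mul, norm_unitExp, norm_unitExp, one_mul, one_mul]

theorem lintegral_enorm_expSum_sq {n : ℕ} (a : Fin n → ℂ) :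
    ∫⁻ u in Set.Ico (0 : ℝ) 1, ‖expSum a u‖ₑ ^ 2 = ∑ k, ‖a k‖ₑ ^ 2 := by
  have hinj : Function.Injective fun k : Fin n => (-(k : ℕ) : ℤ) := fun k l h => by
    simpa [Fin.ext_iff] using h
  have h1 := integral_norm_sum_unitExp_sq Finset.univ a hinj
  rw [intervalIntegral.integral_of_le zero_le_one, ← integral_Ico_eq_integral_Ioc] at h1
  have h2 := ofReal_integral_eq_lintegral_ofReal (μ := volume.restrict (Set.Ico (0 : ℝ) 1))
    (f := fun u => ‖expSum a u‖ ^ 2)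
    ((Continuous.integrableOn_Icc (by fun_prop)).mono_set Set.Ico_subset_Icc_self)
    (Filter.Eventually.of_forall fun u => by positivity)
  have h3 (z : ℂ) : ENNReal.ofReal (‖z‖ ^ 2) = ‖z‖ₑ ^ 2 := by
    rw [ENNReal.ofReal_pow (norm_nonneg _), ofReal_norm]
  simp_rw [h3] at h2
  rw [← h2]
  change ENNReal.ofReal (∫ u in Set.Ico (0 : ℝ) 1,
    ‖∑ k, a k * unitExp ((-(k : ℕ) : ℤ) * u)‖ ^ 2) = _
  rw [h1, ENNReal.ofReal_sum_of_nonneg fun k _ => by positivity]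
  simp_rw [h3]

open ComplexConjugate in
/-- An exponential sum with `n` frequencies is controlled by translates, through a small interval,
of exponential sums with the same total mass. -/
theorem exists_norm_expSum_sq_le_sum_translates {n N : ℕ} (hN : 2 ≤ N) {η : ℝ} (hη : 0 ≤ η)
    (hn : 1 ≤ n) (hβ : ((n : ℝ) - 1) * η ≤ 1) (a : Fin n → ℂ) :
    ∃ (ι : Type) (_ : Fintype ι) (c : ι → Fin n → ℂ),
      (∑ i, ∑ k, ‖c i k‖ ^ 2 ≤ ∑ k, ‖a k‖ ^ 2) ∧
      ∀ s, ‖expSum a s‖ ^ 2 ≤ (((n : ℝ) - 1) * η + 1 / N) *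
        ∑ i, ∑ j ∈ Finset.range N, ‖expSum (c i) (s - j * η)‖ ^ 2 := by
  have hn' : (1 : ℝ) ≤ n := by exact_mod_cast hn
  obtain ⟨ι, hι, q, hq1, hqs⟩ := exists_arc_majorant hN (mul_nonneg (by linarith) hη) hβ
  let Q : ι → Fin n → ℂ := fun i k => ∑ j ∈ Finset.range N, q i j * unitExp (j * (k * η))
  let p : Fin n → ℝ := fun k => ∑ i, ‖Q i k‖ ^ 2
  have hp (k : Fin n) : 1 ≤ p k := hq1 (k * η) ⟨by positivity, by
    gcongr
    have : ((k : ℕ) : ℝ) + 1 ≤ n := by exact_mod_cast k.2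
    linarith⟩
  have hp0 (k : Fin n) : (p k : ℂ) ≠ 0 := by
    have := hp k
    exact_mod_cast (by linarith : p k ≠ 0)
  -- This choice gives `∑ᵢ Qᵢ cᵢ = a`, and `∑ᵢ |cᵢ k|² = |a k|² / p k`, at most `|a k|²` because the
  -- majorant is at least `1` at `kη`.
  let c : ι → Fin n → ℂ := fun i k => conj (Q i k) * a k / p k
  refine ⟨ι, hι, c, ?_, fun s => ?_⟩
  · rw [Finset.sum_comm]
    refine Finset.sum_le_sum fun k _ => ?_
    have h1 (i : ι) : ‖c i k‖ ^ 2 = ‖Q i k‖ ^ 2 * (‖a k‖ ^ 2 / p k ^ 2) := by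
      simp only [c, norm_div, norm_mul, RCLike.norm_conj, Complex.norm_real, Real.norm_eq_abs]
      rw [div_pow, mul_pow, sq_abs]; ring
    simp_rw [h1]
    rw [← Finset.sum_mul]
    change p k * _ ≤ _
    have h2 := hp k
    rw [mul_div_assoc', div_le_iff₀ (by positivity)]
    nlinarith [mul_nonneg (sq_nonneg ‖a k‖) (mul_nonneg (by linarith : 0 ≤ p k) (by linarith : 0 ≤ p k - 1))]
  · have hQc (k : Fin n) : ∑ i, Q i k * c i k = a k := by
      have h1 (i : ι) : Q i k * c i k = ((‖Q i k‖ ^ 2 : ℝ) : ℂ) * (a k / p k) := by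
        simp only [c]
        rw [← Complex.normSq_eq_norm_sq, ← Complex.mul_conj]; ring
      simp_rw [h1]
      rw [← Finset.sum_mul, ← Complex.ofReal_sum]
      exact mul_div_cancel₀ _ (hp0 k)
    -- The character in `Qᵢ(kη)` of frequency `j` turns into the translation of `s` by `jη`.
    have hrep : expSum a s = ∑ x ∈ Finset.univ ×ˢ Finset.range N,
        q x.1 x.2 * expSum (c x.1) (s - x.2 * η) := by
      rw [Finset.sum_product]
      simp only [expSum, Finset.mul_sum]
      simp_rw [Finset.sum_comm (s := Finset.range N)]
      rw [Finset.sum_comm]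
      refine Finset.sum_congr rfl fun k _ => ?_
      conv_lhs => rw [← hQc k, Finset.sum_mul]
      refine Finset.sum_congr rfl fun i _ => ?_
      simp only [Q, Finset.sum_mul]
      refine Finset.sum_congr rfl fun j _ => ?_
      have : ((-(k : ℕ) : ℤ) : ℝ) * (s - j * η) = j * (k * η) + (-(k : ℕ) : ℤ) * s := by
        push_cast; ring
      rw [this, unitExp_add]; ring
    have hcs : ‖expSum a s‖ ^ 2 ≤ (∑ x ∈ Finset.univ ×ˢ Finset.range N, ‖q x.1 x.2‖ ^ 2) *
        ∑ x ∈ Finset.univ ×ˢ Finset.range N, ‖expSum (c x.1) (s - x.2 * η)‖ ^ 2 := by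
      refine le_trans ?_ (Finset.sum_mul_sq_le_sq_mul_sq _ _ _)
      gcongr
      rw [hrep]
      refine (norm_sum_le _ _).trans (le_of_eq ?_)
      simp_rw [norm_mul]
    rw [Finset.sum_product, Finset.sum_product] at hcs
    rwa [hqs] at hcs

/-! ### Integration against a periodic measure -/

theorem IsOnePeriodicMeasure.measure_preimage_add_int {μ : Measure ℝ} (hμ : IsOnePeriodicMeasure μ)
    (m : ℤ) : ∀ {B : Set ℝ}, MeasurableSet B → μ ((fun x => x + (m : ℝ)) ⁻¹' B) = μ B := by
  have h1 {B : Set ℝ} (hB : MeasurableSet B) : μ ((fun x => x + (1 : ℝ)) ⁻¹' B) = μ B := by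
    rw [← hμ _ (hB.preimage (measurable_add_const 1)),
      Set.image_preimage_eq _ (fun x => ⟨x - 1, by simp⟩)]
  induction m using Int.induction_on with
  | zero => simp
  | succ m ih =>
    intro B hB
    rw [← h1 hB, ← ih (hB.preimage (measurable_add_const 1)), ← Set.preimage_comp]
    congr 2; ext x; simp; ring_nf
  | pred m ih =>
    intro B hB
    rw [← h1 (hB.preimage (measurable_add_const _)), ← Set.preimage_comp, ← ih hB]
    congr 2; ext x; simp

theorem lintegral_eq_tsum_lintegral_add_int {F : ℝ → ℝ≥0∞} :
    ∫⁻ u, F u = ∑' m : ℤ, ∫⁻ u in Set.Ico (0 : ℝ) 1, F (u + m) := by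
  rw [← setLIntegral_univ, ← iUnion_Ico_intCast ℝ,
    lintegral_iUnion (fun _ => measurableSet_Ico) (Set.pairwise_disjoint_Ico_intCast ℝ)]
  refine tsum_congr fun m => ?_
  have := (measurePreserving_add_right volume (m : ℝ)).setLIntegral_comp_emb
    (measurableEmbedding_addRight _) F (Set.Ico (0 : ℝ) 1)
  rw [this]
  congr 2
  simp [add_comm]

/-- After `u = s - t` and Tonelli, `f u` is weighted by the mass of `(u, u + δ)` inside one period.
Folding `u` to `[0, 1)` reassembles the whole interval from its pieces. -/
theorem IsOnePeriodicMeasure.lintegral_lintegral_sub_le {μ : Measure ℝ} [SigmaFinite μ]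
    (hμ : IsOnePeriodicMeasure μ) {f : ℝ → ℝ≥0∞} (hf : Measurable f)
    (hper : Function.Periodic f 1) (δ : ℝ) :
    ∫⁻ s in Set.Ico (0 : ℝ) 1, (∫⁻ t in Set.Ioo 0 δ, f (s - t)) ∂μ ≤
      (⨆ r ∈ Set.Ico (0 : ℝ) 1, μ (Set.Ioo r (r + δ))) * ∫⁻ u in Set.Ico (0 : ℝ) 1, f u := by
  let S : Set (ℝ × ℝ) := {x | x.2 < x.1 ∧ x.1 < x.2 + δ}
  have hS : MeasurableSet S :=
    (measurableSet_lt measurable_snd measurable_fst).inter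
      (measurableSet_lt measurable_fst (measurable_snd.add_const δ))
  let K : ℝ → ℝ → ℝ≥0∞ := fun s u => S.indicator (fun x => f x.2) (s, u)
  have hK : Measurable (Function.uncurry K) := (hf.comp measurable_snd).indicator hS
  have hinner (s : ℝ) : ∫⁻ t in Set.Ioo 0 δ, f (s - t) = ∫⁻ u, K s u := by
    rw [← lintegral_indicator measurableSet_Ioo, ← lintegral_sub_left_eq_self _ s]
    refine lintegral_congr fun u => ?_
    simp only [K, S, Set.indicator, Set.mem_Ioo, Set.mem_ofPred_eq, sub_sub_cancel, sub_pos,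
      sub_lt_iff_lt_add']
  simp_rw [hinner]
  rw [lintegral_lintegral_swap hK.aemeasurable]
  have hval (u : ℝ) : ∫⁻ s in Set.Ico (0 : ℝ) 1, K s u ∂μ =
      f u * μ (Set.Ioo u (u + δ) ∩ Set.Ico 0 1) := by
    have : (fun s => K s u) = (Set.Ioo u (u + δ)).indicator fun _ => f u := by
      ext s; simp only [K, S, Set.indicator, Set.mem_Ioo, Set.mem_ofPred_eq]
    rw [this, lintegral_indicator measurableSet_Ioo, Measure.restrict_restrict measurableSet_Ioo,
      lintegral_const, Measure.restrict_apply_univ]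
  have hmeas : Measurable fun u => ∫⁻ s in Set.Ico (0 : ℝ) 1, K s u ∂μ := hK.lintegral_prod_left'
  have hmeas' (m : ℤ) : Measurable fun u : ℝ => ∫⁻ s in Set.Ico (0 : ℝ) 1, K s (u + m) ∂μ :=
    hmeas.comp (measurable_add_const _)
  rw [lintegral_eq_tsum_lintegral_add_int, ← lintegral_tsum fun m => (hmeas' m).aemeasurable,
    ← lintegral_const_mul _ hf]
  refine setLIntegral_mono' measurableSet_Ico fun u hu => ?_
  have hterm (m : ℤ) : ∫⁻ s in Set.Ico (0 : ℝ) 1, K s (u + m) ∂μ =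
      f u * μ (Set.Ioo u (u + δ) ∩ Set.Ico ((-m : ℤ) : ℝ) ((-m : ℤ) + 1)) := by
    rw [hval, ← hμ.measure_preimage_add_int m (measurableSet_Ioo.inter measurableSet_Ico)]
    have hfm : f (u + m) = f u := by simpa using hper.int_mul m u
    rw [hfm]
    congr 2
    ext x
    simp only [Set.mem_preimage, Set.mem_inter_iff, Set.mem_Ioo, Set.mem_Ico]
    push_cast
    constructor <;> rintro ⟨⟨h1, h2⟩, h3, h4⟩ <;> refine ⟨⟨?_, ?_⟩, ?_, ?_⟩ <;> linarith
  simp_rw [hterm]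
  rw [ENNReal.tsum_mul_left, mul_comm]
  gcongr
  have hneg := (Equiv.neg ℤ).tsum_eq
    (fun m : ℤ => μ (Set.Ioo u (u + δ) ∩ Set.Ico (m : ℝ) (m + 1)))
  simp only [Equiv.neg_apply] at hneg
  rw [hneg, ← measure_iUnion (fun i j hij => ((Set.pairwise_disjoint_Ico_intCast ℝ) hij).mono
      Set.inter_subset_right Set.inter_subset_right)
      (fun m => measurableSet_Ioo.inter measurableSet_Ico), ← Set.inter_iUnion,
    iUnion_Ico_intCast, Set.inter_univ]
  exact le_iSup₂ (f := fun r (_ : r ∈ Set.Ico (0 : ℝ) 1) => μ (Set.Ioo r (r + δ))) u hu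

theorem sum_lintegral_translate_le (f : ℝ → ℝ≥0∞) (N : ℕ) {η : ℝ} (hη : 0 < η) :
    ∑ j ∈ Finset.range N, ∫⁻ t in Set.Ioo 0 η, f (t + j * η) ≤ ∫⁻ t in Set.Ioo 0 (N * η), f t := by
  have h1 (j : ℕ) : ∫⁻ t in Set.Ioo 0 η, f (t + j * η) =
      ∫⁻ t in Set.Ioo (j * η) ((j + 1) * η), f t := by
    have := (measurePreserving_add_right volume (j * η)).setLIntegral_comp_emb
      (measurableEmbedding_addRight _) f (Set.Ioo 0 η)
    rw [this]
    congr 2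
    simp
    ring_nf
  simp_rw [h1]
  rw [← lintegral_biUnion_finset ?_ fun _ _ => measurableSet_Ioo]
  · refine lintegral_mono_set (Set.iUnion₂_subset fun j hj x hx => ?_)
    have hj' : (j : ℝ) + 1 ≤ N := by exact_mod_cast Finset.mem_range.1 hj
    exact ⟨lt_of_le_of_lt (by positivity) hx.1, hx.2.trans_le (by gcongr)⟩
  · intro i _ j _ hij
    refine Set.disjoint_left.2 fun x hi hj => hij ?_
    have h2 : (i : ℝ) < j + 1 := lt_of_mul_lt_mul_right (hi.1.trans hj.2) hη.le
    have h3 : (j : ℝ) < i + 1 := lt_of_mul_lt_mul_right (hj.1.trans hi.2) hη.le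
    have h4 : i < j + 1 := by exact_mod_cast h2
    have h5 : j < i + 1 := by exact_mod_cast h3
    omega

/-- The right-hand side is free of `N`, which is what permits the later limit. The condition `n ≤ N`
keeps the arc length `(n-1)δ/N` at most `1`. -/
theorem lintegral_average_expSum_le {μ : Measure ℝ} [SigmaFinite μ] (hμ : IsOnePeriodicMeasure μ)
    {n N : ℕ} (hn : 1 ≤ n) (hnN : n ≤ N) (hN : 2 ≤ N) (a : Fin n → ℂ) {δ : ℝ}
    (hδ : δ ∈ Set.Ioc (0 : ℝ) 1) :
    ∫⁻ s in Set.Ico (0 : ℝ) 1, ENNReal.ofReal (N / δ) *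
        (∫⁻ t in Set.Ioo 0 (δ / N), ‖expSum a (s - t)‖ₑ ^ 2) ∂μ ≤
      ENNReal.ofReal ((n : ℝ) - 1 + 1 / δ) *
        (⨆ r ∈ Set.Ico (0 : ℝ) 1, μ (Set.Ioo r (r + δ))) * ∑ k, ‖a k‖ₑ ^ 2 := by
  have hδ0 := hδ.1
  have hN0 : (0 : ℝ) < N := by positivity
  have hn' : (1 : ℝ) ≤ n := by exact_mod_cast hn
  set η := δ / N with hη
  have hη0 : 0 < η := by positivity
  have hNη : N * η = δ := by rw [hη]; field_simp
  have hβ : ((n : ℝ) - 1) * η ≤ 1 := by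
    have : (n : ℝ) ≤ N := by exact_mod_cast hnN
    calc ((n : ℝ) - 1) * η ≤ N * η := by gcongr; linarith
      _ ≤ 1 := hNη.trans_le hδ.2
  obtain ⟨ι, hι, c, hc, hle⟩ := exists_norm_expSum_sq_le_sum_translates hN hη0.le hn hβ a
  set A : ℝ := ((n : ℝ) - 1) * η + 1 / N with hA
  have hA0 : 0 ≤ A := by
    have := mul_nonneg (sub_nonneg.2 hn') hη0.le
    positivity
  set M := ⨆ r ∈ Set.Ico (0 : ℝ) 1, μ (Set.Ioo r (r + δ))
  have hsq (z : ℂ) : ENNReal.ofReal (‖z‖ ^ 2) = ‖z‖ₑ ^ 2 := by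
    rw [ENNReal.ofReal_pow (norm_nonneg _), ofReal_norm]
  have hle' (s : ℝ) : ‖expSum a s‖ₑ ^ 2 ≤ ENNReal.ofReal A *
      ∑ i, ∑ j ∈ Finset.range N, ‖expSum (c i) (s - j * η)‖ₑ ^ 2 := by
    have := ENNReal.ofReal_le_ofReal (hle s)
    rw [hsq, ENNReal.ofReal_mul hA0, ENNReal.ofReal_sum_of_nonneg fun i _ => by positivity] at this
    refine this.trans (le_of_eq ?_)
    congr 1
    refine Finset.sum_congr rfl fun i _ => ?_
    rw [ENNReal.ofReal_sum_of_nonneg fun i _ => by positivity]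
    simp_rw [hsq]
  have hc' : ∑ i, ∑ k, ‖c i k‖ₑ ^ 2 ≤ ∑ k, ‖a k‖ₑ ^ 2 := by
    have := ENNReal.ofReal_le_ofReal hc
    rw [ENNReal.ofReal_sum_of_nonneg fun i _ => by positivity,
      ENNReal.ofReal_sum_of_nonneg fun i _ => by positivity] at this
    simp_rw [hsq] at this
    refine le_trans (le_of_eq ?_) this
    refine Finset.sum_congr rfl fun i _ => ?_
    rw [ENNReal.ofReal_sum_of_nonneg fun i _ => by positivity]
    simp_rw [hsq]
  have hmeas (b : Fin n → ℂ) : Measurable fun x : ℝ => ‖expSum b x‖ₑ ^ 2 :=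
    (continuous_expSum b).measurable.enorm.pow_const 2
  have hinner (s : ℝ) : ∫⁻ t in Set.Ioo 0 η, ‖expSum a (s - t)‖ₑ ^ 2 ≤
      ENNReal.ofReal A * ∑ i, ∫⁻ t in Set.Ioo 0 δ, ‖expSum (c i) (s - t)‖ₑ ^ 2 := by
    have hm (i : ι) (y : ℝ) : Measurable fun t : ℝ => ‖expSum (c i) (s - t - y)‖ₑ ^ 2 :=
      (hmeas (c i)).comp (by fun_prop)
    refine (lintegral_mono fun t => hle' (s - t)).trans ?_
    rw [lintegral_const_mul _ (by fun_prop)]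
    gcongr
    rw [lintegral_finsetSum _ fun i _ => Finset.measurable_sum _ fun j _ => hm i _]
    refine Finset.sum_le_sum fun i _ => ?_
    rw [lintegral_finsetSum _ fun j _ => hm i _, ← hNη]
    refine le_trans (le_of_eq ?_) (sum_lintegral_translate_le
      (fun t => ‖expSum (c i) (s - t)‖ₑ ^ 2) N hη0)
    simp_rw [sub_sub]
  have hmeas2 (i : ι) :
      Measurable fun s : ℝ => ∫⁻ t in Set.Ioo 0 δ, ‖expSum (c i) (s - t)‖ₑ ^ 2 :=
    Measurable.lintegral_prod_right' (f := fun x : ℝ × ℝ => ‖expSum (c i) (x.1 - x.2)‖ₑ ^ 2)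
      ((hmeas (c i)).comp (measurable_fst.sub measurable_snd))
  have hconst : ENNReal.ofReal (N / δ) * ENNReal.ofReal A =
      ENNReal.ofReal ((n : ℝ) - 1 + 1 / δ) := by
    rw [← ENNReal.ofReal_mul (by positivity)]
    congr 1
    rw [hA, hη]; field_simp
  calc _ ≤ ∫⁻ s in Set.Ico (0 : ℝ) 1, ENNReal.ofReal (N / δ) * (ENNReal.ofReal A *
          ∑ i, ∫⁻ t in Set.Ioo 0 δ, ‖expSum (c i) (s - t)‖ₑ ^ 2) ∂μ := by
        gcongr with s; exact hinner s
    _ = ENNReal.ofReal ((n : ℝ) - 1 + 1 / δ) * ∑ i, ∫⁻ s in Set.Ico (0 : ℝ) 1,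
          (∫⁻ t in Set.Ioo 0 δ, ‖expSum (c i) (s - t)‖ₑ ^ 2) ∂μ := by
        simp_rw [← mul_assoc, hconst]
        rw [lintegral_const_mul _ (Finset.measurable_sum _ fun i _ => hmeas2 i),
          lintegral_finsetSum _ fun i _ => hmeas2 i]
    _ ≤ ENNReal.ofReal ((n : ℝ) - 1 + 1 / δ) * ∑ i, M * ∑ k, ‖c i k‖ₑ ^ 2 := by
        gcongr with i
        rw [← lintegral_enorm_expSum_sq]
        exact hμ.lintegral_lintegral_sub_le (f := fun x => ‖expSum (c i) x‖ₑ ^ 2) (hmeas _)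
          (fun x => by simp only [expSum_add_one]) δ
    _ ≤ _ := by
        rw [← Finset.mul_sum, mul_assoc]
        gcongr

/-! ### Removing the average -/

theorem le_liminf_average {g : ℝ → ℝ≥0∞} (hg : Continuous g) {δ : ℝ} (hδ : 0 < δ) (s : ℝ) :
    g s ≤ Filter.liminf (fun N : ℕ => ENNReal.ofReal (N / δ) *
      ∫⁻ t in Set.Ioo 0 (δ / N), g (s - t)) Filter.atTop := by
  refine le_of_forall_lt fun b hb => ?_
  obtain ⟨b', hbb', hb'⟩ := exists_between hb
  refine hbb'.trans_le (Filter.le_liminf_of_le (by isBoundedDefault) ?_)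
  have h1 : ∀ᶠ t in nhds (0 : ℝ), b' < g (s - t) := by
    have : Continuous fun t => g (s - t) := by fun_prop
    exact (this.tendsto 0).eventually (Ioi_mem_nhds (by simpa using hb'))
  obtain ⟨ε, hε, hball⟩ := Metric.eventually_nhds_iff.1 h1
  have h2 := (tendsto_const_div_atTop_nhds_zero_nat δ).eventually (Iio_mem_nhds hε)
  filter_upwards [h2, Filter.eventually_gt_atTop 0] with N hN hN0
  have hN0' : (0 : ℝ) < N := by exact_mod_cast hN0
  calc b' = ENNReal.ofReal (N / δ) * ∫⁻ t in Set.Ioo 0 (δ / N), b' := by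
        rw [lintegral_const, Measure.restrict_apply_univ, Real.volume_Ioo, sub_zero, mul_left_comm,
          ← ENNReal.ofReal_mul (by positivity), div_mul_div_cancel₀ hδ.ne', div_self hN0'.ne',
          ENNReal.ofReal_one, mul_one]
    _ ≤ _ := by
        refine mul_le_mul' le_rfl
          (setLIntegral_mono' measurableSet_Ioo fun t ht => (hball ?_).le)
        rw [Real.dist_eq, sub_zero, abs_of_pos ht.1]
        exact ht.2.trans hN

theorem mainTheorem4 (μ : Measure ℝ) [SigmaFinite μ] (hμ : IsOnePeriodicMeasure μ)
    (n : ℕ) (φ : ℝ) (hφ : φ ∈ Set.Ico (0 : ℝ) 1) (a : EuclideanSpace ℂ (Fin n))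
    (δ : ℝ) (hδ : δ ∈ Set.Ioc (0 : ℝ) 1) :
    ∫⁻ s in Set.Ico (0 : ℝ) 1, ‖trigPoly φ a s‖ₑ ^ 2 ∂μ ≤
      ENNReal.ofReal ((n : ℝ) - 1 + 1 / δ) *
        (⨆ r ∈ Set.Ico (0 : ℝ) 1, μ (Set.Ioo r (r + δ))) * ‖a‖ₑ ^ 2 := by
  -- For `n = 0` the arc would have negative length, so this case is separate.
  rcases Nat.eq_zero_or_pos n with rfl | hn
  · simp [trigPoly]
  have hnorm (s : ℝ) : ‖trigPoly φ a s‖ₑ = ‖expSum a s‖ₑ := by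
    rw [← ofReal_norm, norm_trigPoly, ofReal_norm]
  have ha : ‖a‖ₑ ^ 2 = ∑ k, ‖a k‖ₑ ^ 2 := by
    have h (E : Type) [NormedAddCommGroup E] (z : E) : ‖z‖ₑ ^ 2 = ENNReal.ofReal (‖z‖ ^ 2) := by
      rw [ENNReal.ofReal_pow (norm_nonneg _), ofReal_norm]
    simp_rw [h]
    rw [EuclideanSpace.norm_sq_eq, ENNReal.ofReal_sum_of_nonneg fun i _ => by positivity]
  simp_rw [hnorm, ha]
  have hcont : Continuous fun x : ℝ => ‖expSum a x‖ₑ ^ 2 :=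
    (ENNReal.continuous_pow 2).comp (continuous_expSum a).enorm
  refine (lintegral_mono fun s => le_liminf_average hcont hδ.1 s).trans ?_
  -- Fatou's lemma needs no domination, so `μ` may have infinite mass on a period.
  refine (lintegral_liminf_le fun N => ?_).trans ?_
  · refine Measurable.const_mul ?_ _
    exact Measurable.lintegral_prod_right' (f := fun x : ℝ × ℝ => ‖expSum a (x.1 - x.2)‖ₑ ^ 2)
      (hcont.measurable.comp (measurable_fst.sub measurable_snd))
  · refine Filter.liminf_le_of_frequently_le' (Filter.Eventually.frequently ?_)
    filter_upwards [Filter.eventually_ge_atTop n, Filter.eventually_ge_atTop 2] with N h1 h2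
    exact lintegral_average_expSum_le hμ hn h1 h2 a hδ
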